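/- Let $V$ be a non-empty smooth manifold of dimension $2n+1$ (Hausdorff, second countable, without boundary, not necessarily closed), and let $\lambda$ be a contact form on $V$ whose Reeb vector field generates a circle action $e_t$, $t\in\mathbb{R}/\mathbb{Z}$ (so $e_1=\mathrm{id}$). Equip $V$ with the contact structure $\xi=\ker\lambda$, co-oriented by $\lambda$; a contactomorphism is a diffeomorphism of $V$ preserving $\xi$ and its co-orientation. Let $\mathcal{G}_c$ be the identity component of the group of compactly supported contactomorphisms of $V$ (those joined to $\mathrm{id}$ by a smooth contact isotopy $\{f_t\}_{t\in[0,1]}$ supported in a fixed compact set), let $\mathcal{G}_e$ be the group of contactomorphisms of the form $e_t\circ\phi$ with $\phi\in\mathcal{G}_c$, and let $\widetilde{\mathcal{G}}_e$ be its universal cover, i.e. the group, under pointwise composition, of homotopy classes with fixed end points of smooth paths $\{f_t\}_{t\in[0,1]}$ in $\mathcal{G}_e$ with $f_0=\mathrm{id}$. Here smooth paths in $\mathcal{G}_e$, and the homotopies between them, are smooth families of the form $e_{a}\circ\phi$ with $a$ a smooth real function of the parameters and all the $\phi$ supported in one compact set. On the symplectization $SV=(V\times\mathbb{R}_{+},d(s\lambda))$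 the contact Hamiltonian of a path $\{f_t\}$ is $F_t(f_t(x),s)=s\,\lambda\big(\tfrac{d}{dt}f_t(x)\big)$. For $f\in\widetilde{\mathcal{G}}_e$ write $f\succeq\mathrm{id}$ if some path in the class $f$ has a non-negative contact Hamiltonian, and write $f\succeq g$ (equivalently $g\preceq f$) if $fg^{-1}\succeq\mathrm{id}$. Assume that $V$ is orderable, i.e. that $\succeq$ is a partial order on $\widetilde{\mathcal{G}}_e$. Let $e\in\widetilde{\mathcal{G}}_e$ be the class of the path $\{e_t\}_{t\in[0,1]}$. Then for every $f\in\widetilde{\mathcal{G}}_e$ the minimum and the maximum $$\nu_+(f)=\min\{m\in\mathbb{Z}: e^m\succeq f\},\qquad \nu_-(f)=\max\{m\in\mathbb{Z}: e^m\preceq f\}$$ exist, and $\nu(f)=\max(|\nu_+(f)|,|\nu_-(f)|)$ is a conjugation-invariant norm on $\widetilde{\mathcal{G}}_e$. That is, for all $f,g\in\widetilde{\mathcal{G}}_e$: $\nu(f)\ge 0$, $\nu(\mathrm{id})=0$, $\nu(f)>0$ if $f\ne\mathrm{id}$, $\nu(fg)\le\nu(f)+\nu(g)$, $\nu(f^{-1})=\nu(f)$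 and $\nu(g^{-1}fg)=\nu(f)$. -/

import Mathlib

open Set Filter Topology
open scoped Manifold ContDiff

namespace ContactGeometry

/-- The exterior derivative `dα` of a 1-form `α` on a manifold without boundary, at the point `x`.
It is computed in the preferred chart `φ` at `x`: with `A := (φ⁻¹)^* α`, a 1-form on an open subset
of the model space, `dA (u, v) = (D_u A) v - (D_v A) u`.  (Mathlib identifies `T_x V` with the model
space through the derivative of the preferred chart at `x`.) -/
noncomputable def extDerivForm {n : ℕ} {V : Type*} [TopologicalSpace V]
    [ChartedSpace (EuclideanSpace ℝ (Fin (2 * n + 1))) V]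
    (α : ∀ x : V, TangentSpace (𝓡 (2 * n + 1)) x →L[ℝ] ℝ) (x : V)
    (u v : TangentSpace (𝓡 (2 * n + 1)) x) : ℝ :=
  let A : EuclideanSpace ℝ (Fin (2 * n + 1)) → EuclideanSpace ℝ (Fin (2 * n + 1)) →L[ℝ] ℝ :=
    fun y => (α ((extChartAt (𝓡 (2 * n + 1)) x).symm y)).comp
      (mfderiv (𝓡 (2 * n + 1)) (𝓡 (2 * n + 1)) (extChartAt (𝓡 (2 * n + 1)) x).symm y)
  let y₀ := extChartAt (𝓡 (2 * n + 1)) x x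
  fderiv ℝ A y₀ u v - fderiv ℝ A y₀ v u

/-- A (smooth) contact form on a manifold of dimension `2n+1`: a 1-form `α`, smooth as a fibrewise
linear function on the tangent bundle, which vanishes nowhere and whose exterior derivative is
nondegenerate on the hyperplanes `ker α`, i.e. `α ∧ (dα)^n` vanishes nowhere.  The associated
co-oriented contact structure is `ker α`, with positive side `{α > 0}`. -/
structure ContactForm (n : ℕ) (V : Type*) [TopologicalSpace V]
    [ChartedSpace (EuclideanSpace ℝ (Fin (2 * n + 1))) V] [IsManifold (𝓡 (2 * n + 1)) ∞ V] where
  form : ∀ x : V, TangentSpace (𝓡 (2 * n + 1)) x →L[ℝ] ℝ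
  smooth : ContMDiff (𝓡 (2 * n + 1)).tangent 𝓘(ℝ, ℝ) ∞
    (fun w : TangentBundle (𝓡 (2 * n + 1)) V => form w.1 w.2)
  ne_zero : ∀ x, form x ≠ 0
  nondegenerate : ∀ (x : V) (u : TangentSpace (𝓡 (2 * n + 1)) x), form x u = 0 →
    (∀ v : TangentSpace (𝓡 (2 * n + 1)) x, form x v = 0 → extDerivForm form x u v = 0) → u = 0

variable {n : ℕ} {V : Type*} [TopologicalSpace V]
  [ChartedSpace (EuclideanSpace ℝ (Fin (2 * n + 1))) V] [IsManifold (𝓡 (2 * n + 1)) ∞ V]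

/-- Cartan's formula in a chart, for the flow of a Reeb field. -/
theorem reeb_calculus {E : Type*} [NormedAddCommGroup E] [NormedSpace ℝ E]
    {A : E → E →L[ℝ] ℝ} {G : ℝ × E → E} {y₀ : E} (hGs : ContDiffAt ℝ ∞ G (0, y₀))
    (hG0 : ∀ᶠ y in 𝓝 y₀, G (0, y) = y) (hAs : DifferentiableAt ℝ A y₀)
    (h1 : ∀ᶠ y in 𝓝 y₀, A y (fderiv ℝ G (0, y) (1, 0)) = 1)
    (h2 : ∀ w, fderiv ℝ A y₀ (fderiv ℝ G (0, y₀) (1, 0)) w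
      = fderiv ℝ A y₀ w (fderiv ℝ G (0, y₀) (1, 0))) (v : E) :
    HasDerivAt (fun h : ℝ => A (G (h, y₀)) (fderiv ℝ G (h, y₀) (0, v))) 0 0 := by
  have hD : DifferentiableAt ℝ (fderiv ℝ G) (0, y₀) :=
    (hGs.fderiv_right (m := 1) (by norm_cast)).differentiableAt (by simp)
  have hGd : DifferentiableAt ℝ G (0, y₀) := hGs.differentiableAt (by simp)
  have hAd : HasFDerivAt A (fderiv ℝ A y₀) y₀ := hAs.hasFDerivAt
  have hG00 : G (0, y₀) = y₀ := hG0.self_of_nhds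
  have hAd' : HasFDerivAt A (fderiv ℝ A y₀) (G (0, y₀)) := by rwa [hG00]
  have hsymm : IsSymmSndFDerivAt ℝ G (0, y₀) := hGs.isSymmSndFDerivAt (by
    rw [minSmoothness_of_isRCLikeNormedField]; exact WithTop.coe_le_coe.2 (le_top : (2 : ℕ∞) ≤ ⊤))
  have hl : HasDerivAt (fun h : ℝ => ((h, y₀) : ℝ × E)) (1, 0) 0 :=
    (hasDerivAt_id 0).prodMk (hasDerivAt_const 0 y₀)
  have hr : HasFDerivAt (fun y : E => ((0, y) : ℝ × E)) (ContinuousLinearMap.inr ℝ ℝ E) y₀ :=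
    hasFDerivAt_prodMk_right 0 y₀
  have hR := (hAd.clm_apply (((hD.hasFDerivAt.comp y₀ hr).clm_apply
    (hasFDerivAt_const ((1, 0) : ℝ × E) y₀))))
  have hR0 := hR.unique ((hasFDerivAt_const (1 : ℝ) y₀).congr_of_eventuallyEq h1)
  have hR1 := congrArg (fun L : E →L[ℝ] ℝ => L v) hR0
  have hgd : HasDerivAt (fun h : ℝ => G (h, y₀)) (fderiv ℝ G (0, y₀) (1, 0)) 0 :=
    HasFDerivAt.comp_hasDerivAt (f := fun h : ℝ => ((h, y₀) : ℝ × E)) 0 hGd.hasFDerivAt hl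
  have hF1 : HasDerivAt (fun h : ℝ => A (G (h, y₀))) _ 0 :=
    HasFDerivAt.comp_hasDerivAt (f := fun h : ℝ => G (h, y₀)) 0 hAd' hgd
  have hF2 : HasDerivAt (fun h : ℝ => fderiv ℝ G (h, y₀)) _ 0 :=
    HasFDerivAt.comp_hasDerivAt (f := fun h : ℝ => ((h, y₀) : ℝ × E)) 0 hD.hasFDerivAt hl
  have hF := hF1.clm_apply (hF2.clm_apply (hasDerivAt_const 0 ((0, v) : ℝ × E)))
  have hid : fderiv ℝ G (0, y₀) (0, v) = v := by
    have h3 := HasFDerivAt.comp (f := fun y : E => ((0, y) : ℝ × E)) y₀ hGd.hasFDerivAt hr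
    have h4 := h3.unique ((hasFDerivAt_id y₀).congr_of_eventuallyEq hG0)
    simpa using congrArg (fun L : E →L[ℝ] E => L v) h4
  have h12 := hsymm.eq (1, 0) (0, v)
  refine hF.congr_deriv ?_
  have hz : fderiv ℝ G (0, y₀) (0 : ℝ × E) = 0 := map_zero _
  rw [hz, add_zero, hid, hG00, h12, h2]
  simp only [ContinuousLinearMap.comp_zero, zero_add, add_apply,
    ContinuousLinearMap.comp_apply, ContinuousLinearMap.flip_apply, ContinuousLinearMap.inr_apply,
    Function.comp_apply, zero_apply] at hR1
  linarith

/-- `R` is the Reeb vector field of the contact form `α`: `α(R) = 1` and `i_R dα = 0`. -/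
def IsReebVectorField (α : ContactForm n V) (R : ∀ x : V, TangentSpace (𝓡 (2 * n + 1)) x) : Prop :=
  ∀ x, α.form x (R x) = 1 ∧ ∀ v, extDerivForm α.form x (R x) v = 0

/-- The Reeb vector field of the contact form `α` generates a circle action `e_t`, `t ∈ ℝ/ℤ`
(written here as a 1-periodic action of `ℝ`). -/
structure PeriodicReebFlow (α : ContactForm n V) where
  field : ∀ x : V, TangentSpace (𝓡 (2 * n + 1)) x
  isReeb : IsReebVectorField α field
  flow : ℝ → Equiv.Perm V
  smooth : ContMDiff (𝓘(ℝ, ℝ).prod (𝓡 (2 * n + 1))) (𝓡 (2 * n + 1)) ∞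
    (fun p : ℝ × V => flow p.1 p.2)
  flow_add : ∀ s t, flow (s + t) = flow s * flow t
  flow_one : flow 1 = 1
  generated : ∀ x, IsMIntegralCurve (I := 𝓡 (2 * n + 1)) (fun t => flow t x) field


local notation "𝔼" => EuclideanSpace ℝ (Fin (2 * n + 1))
local notation "𝕀" => 𝓡 (2 * n + 1)

/-- The 1-form `α` written in the preferred chart at `x`. -/
noncomputable def chartForm (α : ContactForm n V) (x : V) (y : 𝔼) : 𝔼 →L[ℝ] ℝ :=
  (α.form ((extChartAt 𝕀 x).symm y)).comp (mfderiv 𝕀 𝕀 (extChartAt 𝕀 x).symm y)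

theorem chartForm_contDiffAt (α : ContactForm n V) (x : V) {y : 𝔼}
    (hy : y ∈ (extChartAt 𝕀 x).target) : ContDiffAt ℝ ∞ (chartForm α x) y := by
  have hopen : IsOpen (extChartAt 𝕀 x).target := isOpen_extChartAt_target x
  refine ContDiffOn.contDiffAt (s := (extChartAt 𝕀 x).target) ?_ (hopen.mem_nhds hy)
  have h1 := (contMDiffOn_extChartAt_symm (I := 𝕀) (n := ∞) x).contMDiffOn_tangentMapWithin
    (m := ∞) (by simp) hopen.uniqueMDiffOn
  rw [contDiffOn_clm_apply]
  intro u
  have h2 := α.smooth.comp_contMDiffOn h1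
  have h3 : ContMDiffOn 𝕀 (𝕀).tangent ∞ (fun z : 𝔼 => (⟨z, u⟩ : TangentBundle 𝕀 𝔼))
      (extChartAt 𝕀 x).target := by
    intro z _
    exact contMDiffWithinAt_vectorSpace_iff_contDiffWithinAt.2 contDiffWithinAt_const
  have h4 := h2.comp h3 (fun z hz => hz)
  refine (contMDiffOn_iff_contDiffOn.1 h4).congr ?_
  intro z hz
  simp only [chartForm, Function.comp, tangentMapWithin, mfderivWithin_of_isOpen hopen hz]
  rfl


theorem chartForm_eq (α : ContactForm n V) (x : V) (y : 𝔼) (u : 𝔼) :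
    chartForm α x y u = α.form ((extChartAt 𝕀 x).symm y) (mfderiv 𝕀 𝕀 (extChartAt 𝕀 x).symm y u) :=
  rfl

theorem form_congr (α : ContactForm n V) {x y : V} (h : x = y) (u : 𝔼) :
    α.form x u = α.form y u := by
  subst h; rfl

theorem flow_zero {α : ContactForm n V} (e : PeriodicReebFlow α) : e.flow 0 = 1 := by
  have := e.flow_add 0 0
  simpa using this

theorem mdiff_flow {α : ContactForm n V} (e : PeriodicReebFlow α) (t : ℝ) :
    ContMDiff 𝕀 𝕀 ∞ (e.flow t) :=
  e.smooth.comp ((contMDiff_const (c := t)).prodMk contMDiff_id)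

theorem flow_deriv_zero {α : ContactForm n V} (e : PeriodicReebFlow α) (x : V)
    (v : TangentSpace 𝕀 x) :
    HasDerivAt (fun h : ℝ => α.form (e.flow h x) (mfderiv 𝕀 𝕀 (e.flow h) x v)) 0 0 := by
  set φ := extChartAt 𝕀 x with hφ
  set y₀ : 𝔼 := φ x with hy₀
  have hxs : x ∈ φ.source := mem_extChartAt_source x
  have hy₀t : y₀ ∈ φ.target := mem_extChartAt_target x
  have hsrc : IsOpen φ.source := isOpen_extChartAt_source x
  have htgt : IsOpen φ.target := isOpen_extChartAt_target x
  have hsy : φ.symm y₀ = x := φ.left_inv hxs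
  have h0 : ∀ y, e.flow 0 y = y := fun y => by rw [flow_zero]; rfl
  have hφs : ∀ y ∈ φ.target, ContMDiffAt 𝕀 𝕀 ∞ φ.symm y := fun y hy =>
    (contMDiffOn_extChartAt_symm (I := 𝕀) (n := ∞) x).contMDiffAt (htgt.mem_nhds hy)
  have hφd : ∀ y ∈ φ.source, ContMDiffAt 𝕀 𝕀 ∞ φ y := fun y hy =>
    (contMDiffOn_extChartAt (I := 𝕀) (n := ∞) (x := x)).contMDiffAt
      ((chartAt 𝔼 x).open_source.mem_nhds (by simpa [hφ] using hy))
  set ψ : ℝ × 𝔼 → V := fun p => e.flow p.1 (φ.symm p.2) with hψdef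
  set G : ℝ × 𝔼 → 𝔼 := fun p => φ (ψ p) with hG
  set A := chartForm α x with hA
  have hψ : ∀ p : ℝ × 𝔼, p.2 ∈ φ.target → ContMDiffAt 𝓘(ℝ, ℝ × 𝔼) 𝕀 ∞ ψ p := by
    intro p hp
    have h1 : ContMDiffAt 𝓘(ℝ, ℝ × 𝔼) (𝓘(ℝ, ℝ).prod 𝕀) ∞
        (fun p : ℝ × 𝔼 => (p.1, φ.symm p.2)) p :=
      contDiff_fst.contMDiff.contMDiffAt.prodMk
        ((hφs p.2 hp).comp p contDiff_snd.contMDiff.contMDiffAt)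
    exact (e.smooth.contMDiffAt).comp p h1
  have hGp : ∀ p : ℝ × 𝔼, p.2 ∈ φ.target → ψ p ∈ φ.source → ContDiffAt ℝ ∞ G p := by
    intro p hp hp'
    exact contMDiffAt_iff_contDiffAt.1 ((hφd _ hp').comp p (hψ p hp))
  have hψ0 : ∀ y, ψ (0, y) = φ.symm y := fun y => h0 _
  have hGs : ContDiffAt ℝ ∞ G (0, y₀) := hGp _ hy₀t (by rw [hψ0, hsy]; exact hxs)
  have hG0 : ∀ᶠ y in 𝓝 y₀, G (0, y) = y := by
    filter_upwards [htgt.mem_nhds hy₀t] with y hy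
    simp only [hG, hψ0, φ.right_inv hy]
  have hAs : DifferentiableAt ℝ A y₀ :=
    (chartForm_contDiffAt α x hy₀t).differentiableAt (by simp)
  have hAG : ∀ p : ℝ × 𝔼, p.2 ∈ φ.target → ψ p ∈ φ.source → ∀ w : ℝ × 𝔼,
      A (G p) (fderiv ℝ G p w) = α.form (ψ p) (mfderiv 𝓘(ℝ, ℝ × 𝔼) 𝕀 ψ p w) := by
    intro p hp hp' w
    have hψp := hψ p hp
    have h1 : ∀ᶠ q in 𝓝 p, φ.symm (G q) = ψ q := by
      filter_upwards [hψp.continuousAt.preimage_mem_nhds (hsrc.mem_nhds hp')] with q hq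
      exact φ.left_inv hq
    have h2 : HasMFDerivAt 𝓘(ℝ, ℝ × 𝔼) 𝕀 G p (fderiv ℝ G p) :=
      ((hGp p hp hp').differentiableAt (by simp)).hasFDerivAt.hasMFDerivAt
    have h3 := ((hφs (G p) (φ.map_source hp')).mdifferentiableAt (by simp)).hasMFDerivAt
    have h4 := (h3.comp p h2).congr_of_eventuallyEq (h1.mono fun q hq => hq.symm)
    have h5 := congrArg (fun L => L w) h4.mfderiv
    rw [hA, chartForm_eq]
    refine (form_congr α (φ.left_inv hp') _).trans ?_
    exact congrArg (fun u : 𝔼 => α.form (ψ p) u) h5.symm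
  have hsymm_id : ∀ u : 𝔼, (mfderiv 𝕀 𝕀 φ.symm y₀ u : 𝔼) = u := by
    intro u
    have := mfderivWithin_range_extChartAt_symm (I := 𝕀) (x := x)
    rw [ModelWithCorners.Boundaryless.range_eq_univ, mfderivWithin_univ] at this
    exact congrArg (fun L => L u) this
  have key1 : (fun h : ℝ => α.form (e.flow h x) (mfderiv 𝕀 𝕀 (e.flow h) x v)) =ᶠ[𝓝 0]
      fun h => A (G (h, y₀)) (fderiv ℝ G (h, y₀) (0, v)) := by
    have hc : ContinuousAt (fun h : ℝ => ψ (h, y₀)) 0 :=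
      ContinuousAt.comp (f := fun h : ℝ => (h, y₀)) (hψ (0, y₀) hy₀t).continuousAt (by fun_prop)
    have hm : φ.source ∈ 𝓝 (ψ (0, y₀)) :=
      hsrc.mem_nhds (by rw [hψ0, hsy]; exact hxs)
    filter_upwards [hc.preimage_mem_nhds hm] with h hh
    rw [hAG (h, y₀) hy₀t hh]
    have h2 : HasMFDerivAt 𝓘(ℝ, 𝔼) 𝓘(ℝ, ℝ × 𝔼) (fun y : 𝔼 => ((h, y) : ℝ × 𝔼)) y₀
        (ContinuousLinearMap.inr ℝ ℝ 𝔼) := (hasFDerivAt_prodMk_right h y₀).hasMFDerivAt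
    have h3 := ((hψ (h, y₀) hy₀t).mdifferentiableAt (by simp)).hasMFDerivAt.comp y₀ h2
    have h4 := ((mdiff_flow e h).mdifferentiableAt (x := φ.symm y₀) (by simp)).hasMFDerivAt.comp y₀
      ((hφs y₀ hy₀t).mdifferentiableAt (by simp)).hasMFDerivAt
    have h5 := congrArg (fun L => L v) (hasMFDerivAt_unique h3 h4)
    have h6 : ∀ z, z = x → ∀ u : 𝔼, (mfderiv 𝕀 𝕀 (e.flow h) z u : 𝔼) = mfderiv 𝕀 𝕀 (e.flow h) x u := by
      rintro z rfl u; rfl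
    have h7 : (mfderiv 𝓘(ℝ, ℝ × 𝔼) 𝕀 ψ (h, y₀) ((0, v) : ℝ × 𝔼) : 𝔼) =
        mfderiv 𝕀 𝕀 (e.flow h) x v := by
      refine Eq.trans h5 ((h6 _ hsy _).trans ?_)
      exact congrArg (fun u : 𝔼 => (mfderiv 𝕀 𝕀 (e.flow h) x u : 𝔼)) (hsymm_id v)
    exact (form_congr α (x := e.flow h x) (y := ψ (h, y₀)) (by simp only [hψdef, hsy]) _).trans
      (congrArg (fun u : 𝔼 => α.form (ψ (h, y₀)) u) h7.symm)
  have hψ1 : ∀ y ∈ φ.target, (mfderiv 𝓘(ℝ, ℝ × 𝔼) 𝕀 ψ (0, y) ((1, 0) : ℝ × 𝔼) : 𝔼) =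
      e.field (φ.symm y) := by
    intro y hy
    have h2 : HasMFDerivAt 𝓘(ℝ, ℝ) 𝓘(ℝ, ℝ × 𝔼) (fun h : ℝ => ((h, y) : ℝ × 𝔼)) 0
        (ContinuousLinearMap.inl ℝ ℝ 𝔼) := (hasFDerivAt_prodMk_left (0 : ℝ) y).hasMFDerivAt
    have h3 := ((hψ (0, y) hy).mdifferentiableAt (by simp)).hasMFDerivAt.comp (0 : ℝ) h2
    have h4 := e.generated (φ.symm y) 0
    have h5 := congrArg (fun L => L (1 : ℝ)) (hasMFDerivAt_unique h3 h4)
    have h6 : ∀ z, z = φ.symm y → (e.field z : 𝔼) = e.field (φ.symm y) := by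
      rintro z rfl; rfl
    exact Eq.trans h5 ((one_smul ℝ _).trans (h6 _ (h0 _)))
  have key2 : ∀ᶠ y in 𝓝 y₀, A y (fderiv ℝ G (0, y) (1, 0)) = 1 := by
    filter_upwards [htgt.mem_nhds hy₀t, hG0] with y hy hy'
    have h1 := hAG (0, y) hy (by rw [hψ0]; exact φ.map_target hy) (1, 0)
    rw [hy'] at h1
    rw [h1]
    refine (congrArg (fun u : 𝔼 => α.form (ψ (0, y)) u) (hψ1 y hy)).trans ?_
    exact (form_congr α (hψ0 y) _).trans (e.isReeb (φ.symm y)).1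
  have key3 : ∀ w : 𝔼, fderiv ℝ A y₀ (fderiv ℝ G (0, y₀) (1, 0)) w
      = fderiv ℝ A y₀ w (fderiv ℝ G (0, y₀) (1, 0)) := by
    intro w
    have hp : ψ (0, y₀) = x := by rw [hψ0, hsy]
    have h1 : HasMFDerivAt 𝓘(ℝ, ℝ × 𝔼) 𝕀 G (0, y₀) (fderiv ℝ G (0, y₀)) :=
      (hGs.differentiableAt (by simp)).hasFDerivAt.hasMFDerivAt
    have h2 := ((hφd (ψ (0, y₀)) (by rw [hp]; exact hxs)).mdifferentiableAt
      (by simp)).hasMFDerivAt.comp (0, y₀)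
      ((hψ (0, y₀) hy₀t).mdifferentiableAt (by simp)).hasMFDerivAt
    have h3 := congrArg (fun L => L ((1, 0) : ℝ × 𝔼)) (hasMFDerivAt_unique h1 h2)
    have h4 : ∀ z, z = x → ∀ u : 𝔼, (mfderiv 𝕀 𝕀 φ z u : 𝔼) = u := by
      rintro z rfl u
      exact congrArg (fun L => L u) (mfderiv_extChartAt_self (I := 𝕀) (x := z))
    have h6 : ∀ z, z = x → (e.field z : 𝔼) = e.field x := by
      rintro z rfl; rfl
    have h5 : fderiv ℝ G (0, y₀) (1, 0) = (e.field x : 𝔼) :=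
      Eq.trans h3 ((h4 _ hp _).trans ((hψ1 y₀ hy₀t).trans (h6 _ hsy)))
    rw [h5]
    exact sub_eq_zero.1 ((e.isReeb x).2 w)
  exact (reeb_calculus hGs hG0 hAs key2 key3 v).congr_of_eventuallyEq key1


theorem pull_congr (α : ContactForm n V) {F G : V → V} (h : F = G) (x : V) (v : 𝔼) :
    α.form (F x) (mfderiv 𝕀 𝕀 F x v) = α.form (G x) (mfderiv 𝕀 𝕀 G x v) := by
  subst h; rfl

theorem pull_id (α : ContactForm n V) {F : V → V} (h : F = id) (x : V) (v : 𝔼) :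
    α.form (F x) (mfderiv 𝕀 𝕀 F x v) = α.form x v := by
  subst h; rw [mfderiv_id]; rfl

theorem pull_comp (α : ContactForm n V) {F G : V → V} (hF : ContMDiff 𝕀 𝕀 ∞ F)
    (hG : ContMDiff 𝕀 𝕀 ∞ G) (x : V) (v : 𝔼) :
    α.form ((F ∘ G) x) (mfderiv 𝕀 𝕀 (F ∘ G) x v) =
      α.form (F (G x)) (mfderiv 𝕀 𝕀 F (G x) (mfderiv 𝕀 𝕀 G x v)) := by
  rw [mfderiv_comp x (hF.mdifferentiableAt (by simp)) (hG.mdifferentiableAt (by simp))]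
  rfl

/-- The Reeb flow preserves the contact form. -/
theorem flow_preserves_form {α : ContactForm n V} (e : PeriodicReebFlow α) (t : ℝ) (x : V)
    (v : TangentSpace 𝕀 x) :
    α.form (e.flow t x) (mfderiv 𝕀 𝕀 (e.flow t) x v) = α.form x v := by
  set g : ℝ → ℝ := fun t => α.form (e.flow t x) (mfderiv 𝕀 𝕀 (e.flow t) x v) with hg
  have hd : ∀ t, HasDerivAt g 0 t := by
    intro t
    have h1 := flow_deriv_zero e (e.flow t x) (mfderiv 𝕀 𝕀 (e.flow t) x v)
    have h2 : (fun h : ℝ => α.form (e.flow h (e.flow t x))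
        (mfderiv 𝕀 𝕀 (e.flow h) (e.flow t x) (mfderiv 𝕀 𝕀 (e.flow t) x v))) =
        fun h => g (h + t) := by
      funext h
      have h3 : (e.flow (h + t) : V → V) = e.flow h ∘ e.flow t := by rw [e.flow_add]; rfl
      exact ((pull_congr α h3 x v).trans (pull_comp α (mdiff_flow e h) (mdiff_flow e t) x v)).symm
    rw [h2] at h1
    have h6 : HasDerivAt (fun h : ℝ => g (h + t)) 0 (t - t) := by rwa [sub_self]
    have h5 := HasDerivAt.comp_sub_const t t h6
    simpa using h5
  have hc := is_const_of_deriv_eq_zero (fun t => (hd t).differentiableAt) (fun t => (hd t).deriv) t 0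
  refine hc.trans ?_
  exact pull_id α (by rw [flow_zero]; rfl) x v

/-- A contactomorphism: a diffeomorphism preserving the contact structure `ker α` and its
co-orientation. -/
structure IsContactomorphism (α : ContactForm n V) (φ : Equiv.Perm V) : Prop where
  smooth : ContMDiff 𝕀 𝕀 ∞ φ
  smooth_symm : ContMDiff 𝕀 𝕀 ∞ φ.symm
  preserves : ∀ (x : V) (v : TangentSpace 𝕀 x),
    α.form (φ x) (mfderiv 𝕀 𝕀 φ x v) = 0 ↔ α.form x v = 0
  cooriented : ∀ (x : V) (v : TangentSpace 𝕀 x),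
    0 < α.form x v → 0 < α.form (φ x) (mfderiv 𝕀 𝕀 φ x v)

theorem IsContactomorphism.one (α : ContactForm n V) : IsContactomorphism α 1 := by
  have h : ∀ (x : V) (v : TangentSpace 𝕀 x),
      α.form ((1 : Equiv.Perm V) x) (mfderiv 𝕀 𝕀 (1 : Equiv.Perm V) x v) = α.form x v :=
    fun x v => pull_id α rfl x v
  exact ⟨contMDiff_id, contMDiff_id, fun x v => by rw [h], fun x v => by rw [h]; exact id⟩

theorem IsContactomorphism.mul {α : ContactForm n V} {φ ψ : Equiv.Perm V}
    (hφ : IsContactomorphism α φ) (hψ : IsContactomorphism α ψ) :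
    IsContactomorphism α (φ * ψ) := by
  have h : ∀ (x : V) (v : TangentSpace 𝕀 x),
      α.form ((φ * ψ) x) (mfderiv 𝕀 𝕀 (φ * ψ : Equiv.Perm V) x v) =
      α.form (φ (ψ x)) (mfderiv 𝕀 𝕀 φ (ψ x) (mfderiv 𝕀 𝕀 ψ x v)) := by
    intro x v
    exact pull_comp α hφ.smooth hψ.smooth x v
  refine ⟨hφ.smooth.comp hψ.smooth, hψ.smooth_symm.comp hφ.smooth_symm, fun x v => ?_,
    fun x v hv => ?_⟩
  · rw [h, hφ.preserves, hψ.preserves]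
  · rw [h]; exact hφ.cooriented _ _ (hψ.cooriented _ _ hv)

theorem IsContactomorphism.inv {α : ContactForm n V} {φ : Equiv.Perm V}
    (hφ : IsContactomorphism α φ) : IsContactomorphism α φ⁻¹ := by
  have h : ∀ (x : V) (v : TangentSpace 𝕀 x),
      α.form (φ (φ.symm x)) (mfderiv 𝕀 𝕀 φ (φ.symm x) (mfderiv 𝕀 𝕀 φ.symm x v)) =
      α.form x v := by
    intro x v
    have h3 : (φ : V → V) ∘ φ.symm = id := by funext y; simp
    have h4 := mfderiv_comp x ((hφ.smooth.mdifferentiableAt (x := φ.symm x) (by simp)))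
      (hφ.smooth_symm.mdifferentiableAt (x := x) (by simp))
    rw [h3, mfderiv_id] at h4
    refine (form_congr α (φ.apply_symm_apply x) _).trans ?_
    exact congrArg (fun u : 𝔼 => α.form x u) (congrArg (fun L => L v) h4).symm
  refine ⟨hφ.smooth_symm, hφ.smooth, fun x v => ?_, fun x v hv => ?_⟩
  · exact (hφ.preserves (φ.symm x) (mfderiv 𝕀 𝕀 φ.symm x v)).symm.trans (by rw [h])
  · by_contra hcon
    rw [not_lt] at hcon
    have h1 := h x v
    rcases hcon.lt_or_eq with h2 | h2
    · have h3 := hφ.cooriented (φ.symm x) (-(mfderiv 𝕀 𝕀 φ.symm x v))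
        (by rw [map_neg]; exact neg_pos.2 h2)
      rw [map_neg, map_neg, h1] at h3
      linarith
    · have h3 := (hφ.preserves (φ.symm x) (mfderiv 𝕀 𝕀 φ.symm x v)).2 h2
      rw [h1] at h3
      exact hv.ne' h3

theorem flow_neg {α : ContactForm n V} (e : PeriodicReebFlow α) (t : ℝ) :
    e.flow (-t) = (e.flow t)⁻¹ := by
  rw [eq_inv_iff_mul_eq_one, ← e.flow_add, neg_add_cancel, flow_zero]

theorem flow_isContactomorphism {α : ContactForm n V} (e : PeriodicReebFlow α) (t : ℝ) :
    IsContactomorphism α (e.flow t) := by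
  refine ⟨mdiff_flow e t, ?_, fun x v => by rw [flow_preserves_form], fun x v hv => by
    rwa [flow_preserves_form]⟩
  have := mdiff_flow e (-t)
  rwa [flow_neg] at this

theorem flow_add_apply {α : ContactForm n V} (e : PeriodicReebFlow α) (s t : ℝ) (x : V) :
    e.flow (s + t) x = e.flow s (e.flow t x) := by
  rw [e.flow_add]; rfl

theorem flow_neg_flow {α : ContactForm n V} (e : PeriodicReebFlow α) (t : ℝ) (x : V) :
    e.flow (-t) (e.flow t x) = x := by
  rw [flow_neg]; simp

theorem flow_intCast {α : ContactForm n V} (e : PeriodicReebFlow α) (k : ℤ) :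
    e.flow k = 1 := by
  induction k using Int.induction_on with
  | zero => simpa using flow_zero e
  | succ i ih =>
    have h := e.flow_add (((i : ℤ) : ℝ)) 1
    rw [ih, e.flow_one] at h
    simpa using h
  | pred i ih =>
    have h := e.flow_add (((-(i : ℤ) - 1 : ℤ) : ℝ)) 1
    rw [e.flow_one, mul_one] at h
    rw [← h, ← ih]
    congr 1
    push_cast
    ring

/-- The union of the Reeb orbits through a compact set lies in a compact invariant set. -/
theorem exists_compact_saturation {α : ContactForm n V} (e : PeriodicReebFlow α) {K : Set V}
    (hK : IsCompact K) : ∃ L, IsCompact L ∧ ∀ t : ℝ, ∀ x, e.flow t x ∈ K → x ∈ L := by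
  refine ⟨(fun p : ℝ × V => e.flow p.1 p.2) '' (Icc 0 1 ×ˢ K),
    (isCompact_Icc.prod hK).image e.smooth.continuous, fun t x hx => ?_⟩
  refine ⟨(Int.fract (-t), e.flow t x), ⟨⟨Int.fract_nonneg _, (Int.fract_lt_one _).le⟩, hx⟩, ?_⟩
  have h1 : e.flow (-t) = e.flow (Int.fract (-t)) := by
    conv_lhs => rw [← Int.floor_add_fract (-t)]
    rw [e.flow_add, flow_intCast, one_mul]
  simp only [← h1, flow_neg_flow]

variable (n) in
/-- A smooth family of diffeomorphisms of `V`, parametrised by a subset `S` of a normed space: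
`(p, x) ↦ f_p(x)` and `(p, x) ↦ f_p⁻¹(x)` are smooth on `S × V`. -/
structure IsSmoothFamily {P : Type*} [NormedAddCommGroup P] [NormedSpace ℝ P]
    (S : Set P) (f : P → Equiv.Perm V) : Prop where
  smooth : ContMDiffOn (𝓘(ℝ, P).prod 𝕀) 𝕀 ∞ (fun q : P × V => f q.1 q.2) (S ×ˢ univ)
  smooth_symm : ContMDiffOn (𝓘(ℝ, P).prod 𝕀) 𝕀 ∞ (fun q : P × V => (f q.1).symm q.2) (S ×ˢ univ)

section families

set_option linter.unusedSectionVars false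

variable {P Q : Type*} [NormedAddCommGroup P] [NormedSpace ℝ P]
  [NormedAddCommGroup Q] [NormedSpace ℝ Q] {S : Set P} {T : Set Q} {f g : P → Equiv.Perm V}

theorem IsSmoothFamily.one : IsSmoothFamily n S (1 : P → Equiv.Perm V) :=
  ⟨contMDiff_snd.contMDiffOn, contMDiff_snd.contMDiffOn⟩

theorem IsSmoothFamily.inv (hf : IsSmoothFamily n S f) : IsSmoothFamily n S f⁻¹ :=
  ⟨hf.smooth_symm, hf.smooth⟩

theorem IsSmoothFamily.mul (hf : IsSmoothFamily n S f) (hg : IsSmoothFamily n S g) :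
    IsSmoothFamily n S (f * g) where
  smooth := by
    have h := hf.smooth.comp (contMDiffOn_fst.prodMk hg.smooth) (fun q hq => ⟨hq.1, mem_univ _⟩)
    exact h
  smooth_symm := by
    have h := hg.smooth_symm.comp (contMDiffOn_fst.prodMk hf.smooth_symm)
      (fun q hq => ⟨hq.1, mem_univ _⟩)
    exact h

theorem IsSmoothFamily.comp (hf : IsSmoothFamily n S f) {u : Q → P} (hu : ContDiffOn ℝ ∞ u T)
    (huT : MapsTo u T S) : IsSmoothFamily n T (fun q => f (u q)) where
  smooth := by
    have h1 : ContMDiffOn (𝓘(ℝ, Q).prod 𝕀) 𝓘(ℝ, P) ∞ (fun q : Q × V => u q.1) (T ×ˢ univ) :=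
      hu.contMDiffOn.comp contMDiffOn_fst (fun q hq => hq.1)
    exact hf.smooth.comp (h1.prodMk contMDiffOn_snd) (fun q hq => ⟨huT hq.1, mem_univ _⟩)
  smooth_symm := by
    have h1 : ContMDiffOn (𝓘(ℝ, Q).prod 𝕀) 𝓘(ℝ, P) ∞ (fun q : Q × V => u q.1) (T ×ˢ univ) :=
      hu.contMDiffOn.comp contMDiffOn_fst (fun q hq => hq.1)
    exact hf.smooth_symm.comp (h1.prodMk contMDiffOn_snd) (fun q hq => ⟨huT hq.1, mem_univ _⟩)

/-- Smooth reparametrisations of the Reeb flow are smooth families. -/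
theorem isSmoothFamily_flow {α : ContactForm n V} (e : PeriodicReebFlow α) {a : P → ℝ}
    (ha : ContDiffOn ℝ ∞ a S) : IsSmoothFamily n S (fun p => e.flow (a p)) := by
  have h : IsSmoothFamily n univ e.flow := by
    refine ⟨e.smooth.contMDiffOn, ?_⟩
    have h1 : ContMDiff (𝓘(ℝ, ℝ).prod 𝕀) (𝓘(ℝ, ℝ).prod 𝕀) ∞ (fun q : ℝ × V => (-q.1, q.2)) :=
      (contDiff_neg.contMDiff.comp contMDiff_fst).prodMk contMDiff_snd
    have h2 : (fun q : ℝ × V => (e.flow q.1).symm q.2) = fun q => e.flow (-q.1) q.2 := by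
      funext q; rw [flow_neg]; rfl
    rw [h2]
    exact (e.smooth.comp h1).contMDiffOn
  exact h.comp ha (mapsTo_univ _ _)

end families

/-- `𝒢_c(V)`: the contactomorphisms which are joined to the identity by a smooth contact isotopy
`f_t`, `t ∈ [0,1]`, supported in a fixed compact set. -/
def compactContGroup (α : ContactForm n V) : Subgroup (Equiv.Perm V) where
  carrier := {φ | ∃ f : ℝ → Equiv.Perm V, IsSmoothFamily n (Icc 0 1) f ∧
    (∀ t ∈ Icc (0 : ℝ) 1, IsContactomorphism α (f t)) ∧ f 0 = 1 ∧ f 1 = φ ∧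
    ∃ K, IsCompact K ∧ ∀ t ∈ Icc (0 : ℝ) 1, ∀ x ∉ K, f t x = x}
  one_mem' := ⟨1, .one, fun _ _ => .one α, rfl, rfl, ∅, isCompact_empty, fun _ _ _ _ => rfl⟩
  mul_mem' := by
    rintro φ ψ ⟨f, hf, hfc, hf0, hf1, K, hK, hfK⟩ ⟨g, hg, hgc, hg0, hg1, L, hL, hgL⟩
    refine ⟨f * g, hf.mul hg, fun t ht => (hfc t ht).mul (hgc t ht), by simp [hf0, hg0],
      by simp [hf1, hg1], K ∪ L, hK.union hL, fun t ht x hx => ?_⟩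
    rw [mem_union, not_or] at hx
    simp [hgL t ht x hx.2, hfK t ht x hx.1]
  inv_mem' := by
    rintro φ ⟨f, hf, hfc, hf0, hf1, K, hK, hfK⟩
    refine ⟨f⁻¹, hf.inv, fun t ht => (hfc t ht).inv, by simp [hf0], by simp [hf1], K, hK,
      fun t ht x hx => ?_⟩
    rw [Pi.inv_apply, Equiv.Perm.inv_eq_iff_eq, hfK t ht x hx]

theorem compactContGroup_conj {α : ContactForm n V} (e : PeriodicReebFlow α) (t : ℝ)
    {φ : Equiv.Perm V} (h : φ ∈ compactContGroup α) :
    e.flow (-t) * φ * e.flow t ∈ compactContGroup α := by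
  obtain ⟨f, hf, hfc, hf0, hf1, K, hK, hfK⟩ := h
  obtain ⟨L, hL, hKL⟩ := exists_compact_saturation e hK
  refine ⟨fun s => e.flow (-t) * f s * e.flow t, ?_, fun s hs =>
    ((flow_isContactomorphism e _).mul (hfc s hs)).mul (flow_isContactomorphism e _), ?_, ?_,
    L, hL, fun s hs x hx => ?_⟩
  · exact ((isSmoothFamily_flow e contDiffOn_const).mul hf).mul
      (isSmoothFamily_flow e contDiffOn_const)
  · simp only [hf0]
    rw [mul_one, ← e.flow_add, neg_add_cancel, flow_zero]
  · simp only [hf1]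
  · have h1 : e.flow t x ∉ K := fun h => hx (hKL t x h)
    simp only [Equiv.Perm.mul_apply, hfK s hs _ h1, flow_neg_flow]

/-- `𝒢_e(V, α)`: the contactomorphisms of the form `e_t ∘ φ` with `φ ∈ 𝒢_c(V)`. -/
def reebContGroup {α : ContactForm n V} (e : PeriodicReebFlow α) : Subgroup (Equiv.Perm V) where
  carrier := {f | ∃ t : ℝ, ∃ φ ∈ compactContGroup α, f = e.flow t * φ}
  one_mem' := ⟨0, 1, one_mem _, by rw [flow_zero, one_mul]⟩
  mul_mem' := by
    rintro _ _ ⟨s, φ, hφ, rfl⟩ ⟨t, ψ, hψ, rfl⟩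
    refine ⟨s + t, _, mul_mem (compactContGroup_conj e t hφ) hψ, ?_⟩
    rw [e.flow_add, flow_neg]
    group
  inv_mem' := by
    rintro _ ⟨s, φ, hφ, rfl⟩
    refine ⟨-s, _, compactContGroup_conj e (-s) (inv_mem hφ), ?_⟩
    rw [neg_neg, flow_neg]
    group

/-- A smooth family of elements of `𝒢_e`, parametrised by a subset `S` of a normed space:
`f_p = e_{a(p)} ∘ φ_p`, with `a` smooth and with all `φ_p` supported in one compact set. -/
structure IsReebFamily {α : ContactForm n V} (e : PeriodicReebFlow α) {P : Type*}
    [NormedAddCommGroup P] [NormedSpace ℝ P] (S : Set P) (f : P → Equiv.Perm V) : Prop where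
  mem : ∀ p ∈ S, f p ∈ reebContGroup e
  smooth : IsSmoothFamily n S f
  outside : ∃ a : P → ℝ, ContDiffOn ℝ ∞ a S ∧ ∃ K : Set V, IsCompact K ∧
    ∀ p ∈ S, ∀ x ∉ K, f p x = e.flow (a p) x

section families

set_option linter.unusedSectionVars false

variable {P Q : Type*} [NormedAddCommGroup P] [NormedSpace ℝ P]
  [NormedAddCommGroup Q] [NormedSpace ℝ Q] {S : Set P} {T : Set Q} {f g : P → Equiv.Perm V}
  {α : ContactForm n V} {e : PeriodicReebFlow α}

theorem IsReebFamily.one : IsReebFamily e S (1 : P → Equiv.Perm V) :=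
  ⟨fun _ _ => one_mem _, .one, 0, contDiffOn_const, ∅, isCompact_empty, fun p _ x _ => by
    simp [flow_zero]⟩

theorem IsReebFamily.mul (hf : IsReebFamily e S f) (hg : IsReebFamily e S g) :
    IsReebFamily e S (f * g) := by
  obtain ⟨a, ha, K, hK, hfK⟩ := hf.outside
  obtain ⟨b, hb, L, hL, hgL⟩ := hg.outside
  obtain ⟨K', hK', hKK'⟩ := exists_compact_saturation e hK
  refine ⟨fun p hp => mul_mem (hf.mem p hp) (hg.mem p hp), hf.smooth.mul hg.smooth,
    a + b, ha.add hb, K' ∪ L, hK'.union hL, fun p hp x hx => ?_⟩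
  rw [mem_union, not_or] at hx
  have h1 : e.flow (b p) x ∉ K := fun h => hx.1 (hKK' _ _ h)
  simp only [Pi.mul_apply, Equiv.Perm.mul_apply, hgL p hp x hx.2, hfK p hp _ h1, Pi.add_apply,
    flow_add_apply]

theorem IsReebFamily.inv (hf : IsReebFamily e S f) : IsReebFamily e S f⁻¹ := by
  obtain ⟨a, ha, K, hK, hfK⟩ := hf.outside
  obtain ⟨K', hK', hKK'⟩ := exists_compact_saturation e hK
  refine ⟨fun p hp => inv_mem (hf.mem p hp), hf.smooth.inv, -a, ha.neg, K', hK',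
    fun p hp x hx => ?_⟩
  have h1 : e.flow (-a p) x ∉ K := fun h => hx (hKK' _ _ h)
  rw [Pi.inv_apply, Equiv.Perm.inv_eq_iff_eq, Pi.neg_apply, hfK p hp _ h1]
  have h2 := flow_neg_flow e (-a p) x
  rw [neg_neg] at h2
  exact h2.symm

theorem IsReebFamily.comp (hf : IsReebFamily e S f) {u : Q → P} (hu : ContDiffOn ℝ ∞ u T)
    (huT : MapsTo u T S) : IsReebFamily e T (fun q => f (u q)) := by
  obtain ⟨a, ha, K, hK, hfK⟩ := hf.outside
  exact ⟨fun q hq => hf.mem _ (huT hq), hf.smooth.comp hu huT, fun q => a (u q), ha.comp hu huT,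
    K, hK, fun q hq x hx => hfK _ (huT hq) x hx⟩

end families

/-- The group (under pointwise composition) of smooth paths `f_t`, `t ∈ [0,1]`, in `𝒢_e` starting
at the identity.  The values at `t ∉ [0,1]` carry no information: they are forgotten when passing
to homotopy classes. -/
def pathGroup {α : ContactForm n V} (e : PeriodicReebFlow α) :
    Subgroup (ℝ → Equiv.Perm V) where
  carrier := {f | IsReebFamily e (Icc 0 1) f ∧ f 0 = 1}
  one_mem' := ⟨.one, rfl⟩
  mul_mem' := fun hf hg => ⟨hf.1.mul hg.1, by simp [hf.2, hg.2]⟩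
  inv_mem' := fun hf => ⟨hf.1.inv, by simp [hf.2]⟩

/-- Two paths in `𝒢_e` are homotopic with fixed end points: there is a smooth family `F(s,t)`,
`(s,t) ∈ [0,1]²`, in `𝒢_e` with `F(0,t) = f_t`, `F(1,t) = g_t`, `F(s,0) = id` and
`F(s,1) = f_1`. -/
def Homotopic {α : ContactForm n V} (e : PeriodicReebFlow α) (f g : ℝ → Equiv.Perm V) : Prop :=
  ∃ F : ℝ × ℝ → Equiv.Perm V, IsReebFamily e (Icc 0 1 ×ˢ Icc 0 1) F ∧
    (∀ t ∈ Icc (0 : ℝ) 1, F (0, t) = f t ∧ F (1, t) = g t) ∧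
    (∀ s ∈ Icc (0 : ℝ) 1, F (s, 0) = 1 ∧ F (s, 1) = f 1)

theorem isReebFamily_snd {α : ContactForm n V} {e : PeriodicReebFlow α} {f : ℝ → Equiv.Perm V}
    (hf : f ∈ pathGroup e) :
    IsReebFamily e (Icc (0 : ℝ) 1 ×ˢ Icc (0 : ℝ) 1) (fun q : ℝ × ℝ => f q.2) :=
  hf.1.comp contDiffOn_snd (fun _ hq => hq.2)

/-- Homotopy with fixed end points is a congruence on the group of paths. -/
def homotopyCon {α : ContactForm n V} (e : PeriodicReebFlow α) : Con (pathGroup e) where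
  r f g := Homotopic e f g
  iseqv := by
    have h0 : (0 : ℝ) ∈ Icc (0 : ℝ) 1 := ⟨le_rfl, zero_le_one⟩
    have h1 : (1 : ℝ) ∈ Icc (0 : ℝ) 1 := ⟨zero_le_one, le_rfl⟩
    refine ⟨fun f => ⟨_, isReebFamily_snd f.2, fun t _ => ⟨rfl, rfl⟩, fun s _ => ⟨f.2.2, rfl⟩⟩,
      ?_, ?_⟩
    · rintro f g ⟨F, hF, hF1, hF2⟩
      have hfg : (g : ℝ → Equiv.Perm V) 1 = (f : ℝ → Equiv.Perm V) 1 :=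
        (hF1 1 h1).2.symm.trans (hF2 1 h1).2
      refine ⟨_, ((isReebFamily_snd f.2).mul hF.inv).mul (isReebFamily_snd g.2),
        fun t ht => ⟨?_, ?_⟩, fun s hs => ⟨?_, ?_⟩⟩
      · simp [(hF1 t ht).1]
      · simp [(hF1 t ht).2]
      · simp [(hF2 s hs).1, f.2.2, g.2.2]
      · simp [(hF2 s hs).2]
    · rintro f g k ⟨F, hF, hF1, hF2⟩ ⟨G, hG, hG1, hG2⟩
      have hfg : (g : ℝ → Equiv.Perm V) 1 = (f : ℝ → Equiv.Perm V) 1 :=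
        (hF1 1 h1).2.symm.trans (hF2 1 h1).2
      refine ⟨_, (hF.mul (isReebFamily_snd g.2).inv).mul hG,
        fun t ht => ⟨?_, ?_⟩, fun s hs => ⟨?_, ?_⟩⟩
      · simp [(hF1 t ht).1, (hG1 t ht).1]
      · simp [(hF1 t ht).2, (hG1 t ht).2]
      · simp [(hF2 s hs).1, (hG2 s hs).1, g.2.2]
      · simp [(hF2 s hs).2, (hG2 s hs).2]
  mul' := by
    rintro f g k l ⟨F, hF, hF1, hF2⟩ ⟨G, hG, hG1, hG2⟩
    refine ⟨_, hF.mul hG, fun t ht => ⟨?_, ?_⟩, fun s hs => ⟨?_, ?_⟩⟩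
    · simp [(hF1 t ht).1, (hG1 t ht).1]
    · simp [(hF1 t ht).2, (hG1 t ht).2]
    · simp [(hF2 s hs).1, (hG2 s hs).1]
    · simp [(hF2 s hs).2, (hG2 s hs).2]

/-- `𝒢̃_e`, the universal cover of `𝒢_e`: the group of homotopy classes with fixed end points of
paths in `𝒢_e` starting at the identity. -/
abbrev UniversalCover {α : ContactForm n V} (e : PeriodicReebFlow α) : Type _ :=
  (homotopyCon e).Quotient

/-- The contact Hamiltonian `H(f_t) : SV = V × ℝ_{>0} → ℝ` of a contact isotopy `f_t`, `t ∈ [0,1]`: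
`H_t(y, s) = s * α_y(X_t(y))`, where `X_t(f_t(x)) = (d/dt) f_t(x)`.  It is the `ℝ_{>0}`-equivariant
Hamiltonian on `(SV, d(sα))` which generates the lift of `f_t` to `SV`; the Reeb flow has `H = s`. -/
noncomputable def contactHamiltonian (α : ContactForm n V) (f : ℝ → Equiv.Perm V) (t : ℝ)
    (q : V × Ioi (0 : ℝ)) : ℝ :=
  let x := (f t).symm q.1
  (q.2 : ℝ) * α.form (f t x)
    (mfderivWithin 𝓘(ℝ, ℝ) 𝕀 (fun τ => f τ x) (Icc 0 1) t (1 : ℝ))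

/-- `φ ≽ id`: some path in the class `φ` has a non-negative contact Hamiltonian. -/
def IsNonneg {α : ContactForm n V} (e : PeriodicReebFlow α) (φ : UniversalCover e) : Prop :=
  ∃ f : pathGroup e, (f : UniversalCover e) = φ ∧
    ∀ t ∈ Icc (0 : ℝ) 1, ∀ q, 0 ≤ contactHamiltonian α f t q

/-- The relation `f ≽ g`, i.e. `f g⁻¹ ≽ id`, on `𝒢̃_e`. -/
def Succeq {α : ContactForm n V} (e : PeriodicReebFlow α) (f g : UniversalCover e) : Prop :=
  IsNonneg e (f * g⁻¹)

/-- `V` is orderable: `≽` is a partial order on `𝒢̃_e`. -/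
def Orderable {α : ContactForm n V} (e : PeriodicReebFlow α) : Prop :=
  IsPartialOrder (UniversalCover e) (Succeq e)

theorem flow_mem_pathGroup {α : ContactForm n V} (e : PeriodicReebFlow α) :
    e.flow ∈ pathGroup e :=
  ⟨⟨fun t _ => ⟨t, 1, one_mem _, (mul_one _).symm⟩, isSmoothFamily_flow e contDiffOn_id,
    id, contDiffOn_id, ∅, isCompact_empty, fun _ _ _ _ => rfl⟩, flow_zero e⟩

/-- `e ∈ 𝒢̃_e`, the class of the path `e_t`, `t ∈ [0,1]`. -/
def reebClass {α : ContactForm n V} (e : PeriodicReebFlow α) : UniversalCover e :=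
  ((⟨e.flow, flow_mem_pathGroup e⟩ : pathGroup e) : UniversalCover e)

/-- `ν₊(f) = min {m ∈ ℤ | e^m ≽ f}`. -/
noncomputable def nuPlus {α : ContactForm n V} (e : PeriodicReebFlow α)
    (f : UniversalCover e) : ℤ :=
  sInf {m : ℤ | Succeq e (reebClass e ^ m) f}

/-- `ν₋(f) = max {m ∈ ℤ | e^m ≼ f}`. -/
noncomputable def nuMinus {α : ContactForm n V} (e : PeriodicReebFlow α)
    (f : UniversalCover e) : ℤ :=
  sSup {m : ℤ | Succeq e f (reebClass e ^ m)}

/-- `ν(f) = max (|ν₊(f)|, |ν₋(f)|)`. -/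
noncomputable def nu {α : ContactForm n V} (e : PeriodicReebFlow α) (f : UniversalCover e) : ℝ :=
  max |(nuPlus e f : ℝ)| |(nuMinus e f : ℝ)|

/-- A conjugation-invariant norm on a group. -/
structure IsConjInvariantNorm {G : Type*} [Group G] (ν : G → ℝ) : Prop where
  nonneg : ∀ g, 0 ≤ ν g
  one : ν 1 = 0
  pos : ∀ g, g ≠ 1 → 0 < ν g
  mul_le : ∀ g h, ν (g * h) ≤ ν g + ν h
  inv : ∀ g, ν g⁻¹ = ν g
  conj : ∀ g h, ν (h⁻¹ * g * h) = ν g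

end ContactGeometry

/-! The elements `f ≽ id` form a cone `C` in the universal cover. Orderability says that `C`
contains `1`, is closed under products and meets `C⁻¹` only in `1`. Geometry supplies three more
facts. `C` is conjugation-invariant (`IsNonneg.conj`), because a contactomorphism preserves the sign
of `α` on velocities. The class `e` is central (`commute_reebClass`), because it is the class of a
loop. Finally `e` is cofinal (`exists_isNonneg_reebClass_pow_mul`): outside a compact set a path in
`𝒢_e` is a reparametrised Reeb flow, so its velocity has `α`-value at least some `-N`, and composing
with `e_{Nt}` adds exactly `N`.

The rest is algebra (`isConjInvariantNorm_of_order`). In a nontrivial group, cofinality and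
antisymmetry prevent a negative power of `e` from lying in `C`, so `ν₊` and `ν₋` are finite.
Centrality makes `ν₊` subadditive, and `ν₋(f) = -ν₊(f⁻¹)` transfers this to `ν₋`. If both vanish,
then `f` and `f⁻¹` lie in `C`, hence `f = 1`. -/

namespace ContactGeometry

/-! ### Algebra: the norm defined by a central cofinal element of an ordered group. -/

/-- A group with a central element `c` which is cofinal for a bi-invariant partial order carries
the conjugation-invariant norm `max |ν₊| |ν₋|`. -/
theorem isConjInvariantNorm_of_order {G : Type*} [Group G] [Nontrivial G] (C : Set G) (c : G)
    (hone : (1 : G) ∈ C) (hmul : ∀ a ∈ C, ∀ b ∈ C, a * b ∈ C)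
    (hanti : ∀ a ∈ C, a⁻¹ ∈ C → a = 1) (hconj : ∀ a ∈ C, ∀ g, g * a * g⁻¹ ∈ C)
    (hc : c ∈ C) (hcomm : ∀ g, Commute c g) (hcof : ∀ g, ∃ N : ℕ, c ^ N * g ∈ C) :
    (∀ f : G, IsLeast {m : ℤ | c ^ m * f⁻¹ ∈ C} (sInf {m : ℤ | c ^ m * f⁻¹ ∈ C}) ∧
      IsGreatest {m : ℤ | f * (c ^ m)⁻¹ ∈ C} (sSup {m : ℤ | f * (c ^ m)⁻¹ ∈ C})) ∧
    IsConjInvariantNorm (fun f : G => max |((sInf {m : ℤ | c ^ m * f⁻¹ ∈ C} : ℤ) : ℝ)|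
      |((sSup {m : ℤ | f * (c ^ m)⁻¹ ∈ C} : ℤ) : ℝ)|) := by
  have hcz : ∀ (m : ℤ) g, c ^ m * g = g * c ^ m := fun m g => ((hcomm g).zpow_left m).eq
  have hpow : ∀ N : ℕ, c ^ N ∈ C := by
    intro N
    induction N with
    | zero => simpa using hone
    | succ k ih => rw [pow_succ]; exact hmul _ ih _ hc
  -- If `c⁻ᴺ ∈ C` then `cᴺ = 1` by antisymmetry. Cofinality then puts every element in `C`, and
  -- antisymmetry makes the group trivial.
  have hinf : ∀ N : ℕ, 0 < N → (c ^ N)⁻¹ ∉ C := by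
    intro N hN h
    have h1 : c ^ N = 1 := hanti _ (hpow N) h
    have hall : ∀ g : G, g ∈ C := by
      intro g
      obtain ⟨M, hM⟩ := hcof g
      -- The exponent tops `M` up to a multiple of `N`, where `c` to that power is `1`. The natural
      -- subtraction is exact since `M ≤ N * M`.
      have h3 : g = c ^ (N * M - M) * (c ^ M * g) := by
        rw [← mul_assoc, ← pow_add, Nat.sub_add_cancel (Nat.le_mul_of_pos_left M hN), pow_mul, h1]
        simp
      rw [h3]
      exact hmul _ (hpow _) _ hM
    obtain ⟨g, hg⟩ := exists_ne (1 : G)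
    exact hg (hanti g (hall g) (hall _))
  have hzpos : ∀ m : ℤ, c ^ m ∈ C ↔ 0 ≤ m := by
    intro m
    constructor
    · intro h
      by_contra hm
      obtain ⟨k, hk⟩ := Int.eq_ofNat_of_zero_le (a := -m) (by omega)
      refine hinf k (by omega) ?_
      rw [← zpow_natCast, ← zpow_neg, ← hk, neg_neg]
      exact h
    · intro h
      obtain ⟨k, rfl⟩ := Int.eq_ofNat_of_zero_le h
      rw [zpow_natCast]
      exact hpow k
  have hupne : ∀ f : G, ∃ m : ℤ, c ^ m * f⁻¹ ∈ C := fun f => by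
    obtain ⟨N, hN⟩ := hcof f⁻¹
    exact ⟨N, by rwa [zpow_natCast]⟩
  have hdnne : ∀ f : G, ∃ m : ℤ, f * (c ^ m)⁻¹ ∈ C := fun f => by
    obtain ⟨N, hN⟩ := hcof f
    exact ⟨-N, by rwa [zpow_neg, inv_inv, zpow_natCast, ← zpow_natCast, ← hcz, zpow_natCast]⟩
  -- Multiplying `c^m ≽ f` and `f ≽ c^k` gives `c^(m-k) ∈ C`. Thus upper and lower exponents bound
  -- each other, which yields both boundedness statements and `ν₋ ≤ ν₊`.
  have hle : ∀ (f : G) (m k : ℤ), c ^ m * f⁻¹ ∈ C → f * (c ^ k)⁻¹ ∈ C → k ≤ m := by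
    intro f m k hm hk
    have h := hmul _ hm _ hk
    have h1 : c ^ m * f⁻¹ * (f * (c ^ k)⁻¹) = c ^ (m - k) := by rw [zpow_sub]; group
    rw [h1, hzpos] at h
    omega
  have hP : ∀ f : G, IsLeast {m : ℤ | c ^ m * f⁻¹ ∈ C} (sInf {m : ℤ | c ^ m * f⁻¹ ∈ C}) := by
    intro f
    obtain ⟨k, hk⟩ := hdnne f
    have hb : BddBelow {m : ℤ | c ^ m * f⁻¹ ∈ C} := ⟨k, fun m hm => hle f m k hm hk⟩
    -- In `ℤ` the infimum of a nonempty set bounded below is attained; without these two facts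
    -- `sInf` would be the default `0`.
    exact ⟨Int.csInf_mem (hupne f) hb, fun m hm => csInf_le hb hm⟩
  have hM : ∀ f : G, IsGreatest {m : ℤ | f * (c ^ m)⁻¹ ∈ C} (sSup {m : ℤ | f * (c ^ m)⁻¹ ∈ C}) := by
    intro f
    obtain ⟨k, hk⟩ := hupne f
    have hb : BddAbove {m : ℤ | f * (c ^ m)⁻¹ ∈ C} := ⟨k, fun m hm => hle f k m hk hm⟩
    exact ⟨Int.csSup_mem (hdnne f) hb, fun m hm => le_csSup hb hm⟩
  refine ⟨fun f => ⟨hP f, hM f⟩, ?_⟩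
  set p : G → ℤ := fun f => sInf {m : ℤ | c ^ m * f⁻¹ ∈ C} with hp
  set q : G → ℤ := fun f => sSup {m : ℤ | f * (c ^ m)⁻¹ ∈ C} with hq
  have hqp : ∀ f, q f ≤ p f := fun f => hle f _ _ (hP f).1 (hM f).1
  have hp1 : p 1 = 0 := by
    refine (hP 1).unique ⟨?_, fun m hm => ?_⟩
    · simpa using hone
    · simpa [hzpos] using hm
  have hq1 : q 1 = 0 := by
    refine (hM 1).unique ⟨?_, fun m hm => ?_⟩
    · simpa using hone
    · have : c ^ (-m) ∈ C := by simpa using hm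
      rw [hzpos] at this
      omega
  have hpmul : ∀ f g, p (f * g) ≤ p f + p g := by
    intro f g
    refine (hP (f * g)).2 ?_
    have h := hmul _ (hP g).1 _ (hP f).1
    change c ^ (p f + p g) * (f * g)⁻¹ ∈ C
    -- Inversion reverses the factors of `f * g`; centrality of `c` lets each power join its own
    -- factor.
    have h1 : c ^ (p f + p g) * (f * g)⁻¹ = c ^ p g * g⁻¹ * (c ^ p f * f⁻¹) := by
      rw [mul_assoc, ← mul_assoc g⁻¹, ← hcz (p f) g⁻¹, add_comm, zpow_add, mul_inv_rev]
      simp only [mul_assoc]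
    rw [h1]; exact h
  have hpinv : ∀ f, p f⁻¹ = - q f := by
    intro f
    refine (hP f⁻¹).unique ⟨?_, fun m hm => ?_⟩
    · have := (hM f).1
      change c ^ (- q f) * f⁻¹⁻¹ ∈ C
      rw [inv_inv, hcz, zpow_neg]
      exact this
    · have h := (hM f).2 (show f * (c ^ (-m))⁻¹ ∈ C by
        rw [zpow_neg, inv_inv, ← hcz]
        simpa using hm)
      change -m ≤ q f at h
      omega
  have hqinv : ∀ f, q f⁻¹ = - p f := by
    intro f
    have := hpinv f⁻¹
    rw [inv_inv] at this
    omega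
  have hqmul : ∀ f g, q f + q g ≤ q (f * g) := by
    intro f g
    have h := hpmul g⁻¹ f⁻¹
    rw [← mul_inv_rev, hpinv, hpinv, hpinv] at h
    omega
  have hpconj : ∀ f g, p (g⁻¹ * f * g) = p f := by
    have key : ∀ f g, p (g⁻¹ * f * g) ≤ p f := by
      intro f g
      refine (hP (g⁻¹ * f * g)).2 ?_
      have h := hconj _ (hP f).1 g⁻¹
      change c ^ p f * (g⁻¹ * f * g)⁻¹ ∈ C
      have h1 : c ^ p f * (g⁻¹ * f * g)⁻¹ = g⁻¹ * (c ^ p f * f⁻¹) * g⁻¹⁻¹ := by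
        rw [← mul_assoc g⁻¹, ← hcz]
        group
      rw [h1]; exact h
    intro f g
    refine le_antisymm (key f g) ?_
    -- The reverse inequality is the same one applied to the conjugate, conjugated back.
    have h := key (g⁻¹ * f * g) g⁻¹
    have h1 : g⁻¹⁻¹ * (g⁻¹ * f * g) * g⁻¹ = f := by group
    rwa [h1] at h
  have hqconj : ∀ f g, q (g⁻¹ * f * g) = q f := by
    intro f g
    have h := hpconj f⁻¹ g
    have h1 : g⁻¹ * f⁻¹ * g = (g⁻¹ * f * g)⁻¹ := by group
    rw [h1, hpinv, hpinv] at h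
    omega
  change IsConjInvariantNorm (fun f : G => max |(p f : ℝ)| |(q f : ℝ)|)
  refine ⟨fun g => le_max_of_le_left (abs_nonneg _), by simp [hp1, hq1], fun g hg => ?_,
    fun f g => ?_, fun f => ?_, fun f g => by simp only [hpconj, hqconj]⟩
  · by_contra hcon
    have h0 := le_antisymm (not_lt.1 hcon) (le_max_of_le_left (abs_nonneg _))
    have hp0 : p g = 0 := by
      have := (le_max_left |(p g : ℝ)| |(q g : ℝ)|).trans h0.le
      exact_mod_cast abs_nonpos_iff.1 this
    have hq0 : q g = 0 := by
      have := (le_max_right |(p g : ℝ)| |(q g : ℝ)|).trans h0.le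
      exact_mod_cast abs_nonpos_iff.1 this
    have h1 : c ^ p g * g⁻¹ ∈ C := (hP g).1
    have h2 : g * (c ^ q g)⁻¹ ∈ C := (hM g).1
    rw [hp0, zpow_zero, one_mul] at h1
    rw [hq0, zpow_zero, inv_one, mul_one] at h2
    exact hg (hanti g h2 h1)
  -- The chain `q f + q g ≤ q (f * g) ≤ p (f * g) ≤ p f + p g` confines both invariants of the
  -- product to the interval of radius `ν(f) + ν(g)` about `0`.
  · have h1 : (p (f * g) : ℝ) ≤ p f + p g := by exact_mod_cast hpmul f g
    have h2 : (q f + q g : ℝ) ≤ q (f * g) := by exact_mod_cast hqmul f g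
    have h3 : (q (f * g) : ℝ) ≤ p (f * g) := by exact_mod_cast hqp (f * g)
    have a1 := abs_le.1 (le_max_left |(p f : ℝ)| |(q f : ℝ)|)
    have a2 := abs_le.1 (le_max_right |(p f : ℝ)| |(q f : ℝ)|)
    have b1 := abs_le.1 (le_max_left |(p g : ℝ)| |(q g : ℝ)|)
    have b2 := abs_le.1 (le_max_right |(p g : ℝ)| |(q g : ℝ)|)
    refine max_le (abs_le.2 ⟨?_, ?_⟩) (abs_le.2 ⟨?_, ?_⟩) <;> linarith
  · simp only [hpinv, hqinv, Int.cast_neg, abs_neg, max_comm]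

section

set_option linter.unusedSectionVars false

variable {n : ℕ} {V : Type*} [TopologicalSpace V]
  [ChartedSpace (EuclideanSpace ℝ (Fin (2 * n + 1))) V] [IsManifold (𝓡 (2 * n + 1)) ∞ V]
  {α : ContactForm n V} {e : PeriodicReebFlow α}

local notation "𝔼" => EuclideanSpace ℝ (Fin (2 * n + 1))
local notation "𝕀" => 𝓡 (2 * n + 1)

/-! ### Contactomorphisms and the sign of the contact Hamiltonian. -/

theorem mk_eq_mk_iff {f g : pathGroup e} :
    (f : UniversalCover e) = g ↔ Homotopic e f g :=
  (homotopyCon e).eq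

theorem isContactomorphism_of_mem_compactContGroup {φ : Equiv.Perm V}
    (h : φ ∈ compactContGroup α) : IsContactomorphism α φ := by
  obtain ⟨f, -, hfc, -, rfl, -⟩ := h
  exact hfc 1 ⟨zero_le_one, le_rfl⟩

theorem isContactomorphism_of_mem_reebContGroup {φ : Equiv.Perm V}
    (h : φ ∈ reebContGroup e) : IsContactomorphism α φ := by
  obtain ⟨t, ψ, hψ, rfl⟩ := h
  exact (flow_isContactomorphism e t).mul (isContactomorphism_of_mem_compactContGroup hψ)

/-- The value of `α` on the velocity of the path `f` at `f t x`. -/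
noncomputable def velocityForm (α : ContactForm n V) (f : ℝ → Equiv.Perm V) (t : ℝ) (x : V) : ℝ :=
  α.form (f t x) (mfderivWithin 𝓘(ℝ, ℝ) 𝕀 (fun τ => f τ x) (Icc 0 1) t (1 : ℝ))

/-- The Hamiltonian is indexed by the end point `f t x` and scaled by a positive factor. Neither
affects the sign condition over all points, so one may work with `velocityForm`, indexed by the
starting point. -/
theorem contactHamiltonian_nonneg_iff {f : ℝ → Equiv.Perm V} {t : ℝ} :
    (∀ q, 0 ≤ contactHamiltonian α f t q) ↔ ∀ x, 0 ≤ velocityForm α f t x := by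
  constructor
  · intro h x
    have h1 : 0 ≤ (1 : ℝ) * velocityForm α f t ((f t).symm (f t x)) :=
      h (f t x, ⟨1, mem_Ioi.2 one_pos⟩)
    rwa [Equiv.symm_apply_apply, one_mul] at h1
  · intro h q
    exact mul_nonneg (le_of_lt q.2.2) (h _)

theorem mdifferentiableWithinAt_path {f : ℝ → Equiv.Perm V} (hf : IsSmoothFamily n (Icc 0 1) f)
    {t : ℝ} (ht : t ∈ Icc (0 : ℝ) 1) (x : V) :
    MDifferentiableWithinAt 𝓘(ℝ, ℝ) 𝕀 (fun τ => f τ x) (Icc 0 1) t := by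
  have h1 : ContMDiffOn 𝓘(ℝ, ℝ) (𝓘(ℝ, ℝ).prod 𝕀) ∞ (fun τ : ℝ => (τ, x)) (Icc 0 1) :=
    contMDiffOn_id.prodMk contMDiffOn_const
  have h2 : ContMDiffOn 𝓘(ℝ, ℝ) 𝕀 ∞ (fun τ => f τ x) (Icc 0 1) :=
    hf.smooth.comp h1 fun τ hτ => ⟨hτ, mem_univ _⟩
  exact (h2 t ht).mdifferentiableWithinAt (by simp)

theorem uniqueMDiffWithinAt_Icc {t : ℝ} (ht : t ∈ Icc (0 : ℝ) 1) :
    UniqueMDiffWithinAt 𝓘(ℝ, ℝ) (Icc (0 : ℝ) 1) t :=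
  ((uniqueDiffOn_Icc zero_lt_one) t ht).uniqueMDiffWithinAt

/-- The new velocity is the image under `dφ` of the old one at `ψ x`. A contactomorphism need not
preserve `α`, but it preserves its sign: the positive case is co-orientation, the zero case is
invariance of `ker α`. -/
theorem velocityForm_comp_nonneg {f : ℝ → Equiv.Perm V} (hf : IsSmoothFamily n (Icc 0 1) f)
    {t : ℝ} (ht : t ∈ Icc (0 : ℝ) 1) {φ ψ : Equiv.Perm V} (hφ : IsContactomorphism α φ)
    {x : V} (h : 0 ≤ velocityForm α f t (ψ x)) :
    0 ≤ velocityForm α (fun τ => φ * f τ * ψ) t x := by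
  have h0 := (hφ.smooth.mdifferentiableAt (x := f t (ψ x)) (by simp)).hasMFDerivAt
  have h1 := (h0.comp_hasMFDerivWithinAt t
    (mdifferentiableWithinAt_path hf ht (ψ x)).hasMFDerivWithinAt).mfderivWithin
      (uniqueMDiffWithinAt_Icc ht)
  have h2 : velocityForm α (fun τ => φ * f τ * ψ) t x = α.form (φ (f t (ψ x)))
      (mfderiv 𝕀 𝕀 φ (f t (ψ x))
        (mfderivWithin 𝓘(ℝ, ℝ) 𝕀 (fun τ => f τ (ψ x)) (Icc 0 1) t (1 : ℝ))) :=
    congrArg (fun L : ℝ →L[ℝ] 𝔼 => α.form (φ (f t (ψ x))) (L 1)) h1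
  rw [h2]
  rcases h.lt_or_eq with h3 | h3
  · exact (hφ.cooriented _ _ h3).le
  · exact ((hφ.preserves _ _).2 h3.symm).ge

/-! ### Conjugation in the universal cover. -/

theorem conj_path_mem {f g : ℝ → Equiv.Perm V} (hf : f ∈ pathGroup e) (hg : g ∈ pathGroup e) :
    (fun τ => g 1 * f τ * (g 1)⁻¹) ∈ pathGroup e := by
  have h1 : IsReebFamily e (Icc (0 : ℝ) 1) (fun _ : ℝ => g 1) :=
    hg.1.comp (u := fun _ => (1 : ℝ)) contDiffOn_const fun _ _ => ⟨zero_le_one, le_rfl⟩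
  exact ⟨(h1.mul hf.1).mul h1.inv, by simp [hf.2]⟩

/-- The conjugator slides along `g` from `g t` at `s = 0` to `g 1` at `s = 1`. At `t = 0` the middle
factor is the identity, and at `t = 1` the conjugator is always `g 1`, so the end points stay fixed.
-/
theorem homotopic_conj {f g : ℝ → Equiv.Perm V} (hf : f ∈ pathGroup e) (hg : g ∈ pathGroup e) :
    Homotopic e (g * f * g⁻¹) (fun τ => g 1 * f τ * (g 1)⁻¹) := by
  have h1 : IsReebFamily e (Icc (0 : ℝ) 1 ×ˢ Icc (0 : ℝ) 1)
      (fun q : ℝ × ℝ => g (q.2 + q.1 * (1 - q.2))) := by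
    refine hg.1.comp (u := fun q : ℝ × ℝ => q.2 + q.1 * (1 - q.2)) (by fun_prop) ?_
    rintro ⟨s, t⟩ ⟨hs, ht⟩
    simp only [mem_Icc] at hs ht ⊢
    constructor <;> nlinarith
  refine ⟨_, (h1.mul (isReebFamily_snd hf)).mul h1.inv, fun t _ => ⟨?_, ?_⟩, fun s _ => ⟨?_, ?_⟩⟩
  · simp
  · simp
  · simp [hf.2]
  · simp

/-- The conjugator `f (t * (1 - s))` contracts to the identity. The end point moves only through
conjugates of `e_1`, and these are all the identity because `e_1 = id`. -/
theorem homotopic_conj_flow {f : ℝ → Equiv.Perm V} (hf : f ∈ pathGroup e) :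
    Homotopic e (f * e.flow * f⁻¹) e.flow := by
  have h1 : IsReebFamily e (Icc (0 : ℝ) 1 ×ˢ Icc (0 : ℝ) 1)
      (fun q : ℝ × ℝ => f (q.2 * (1 - q.1))) := by
    refine hf.1.comp (u := fun q : ℝ × ℝ => q.2 * (1 - q.1)) (by fun_prop) ?_
    rintro ⟨s, t⟩ ⟨hs, ht⟩
    simp only [mem_Icc] at hs ht ⊢
    constructor <;> nlinarith
  refine ⟨_, (h1.mul (isReebFamily_snd (flow_mem_pathGroup e))).mul h1.inv,
    fun t _ => ⟨?_, ?_⟩, fun s _ => ⟨?_, ?_⟩⟩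
  · simp
  · simp [hf.2]
  · simp [hf.2, flow_zero]
  · simp [e.flow_one]

theorem commute_reebClass (φ : UniversalCover e) : Commute (reebClass e) φ := by
  induction φ using Con.induction_on with
  | _ f =>
  have h : (f : UniversalCover e) * reebClass e * (f : UniversalCover e)⁻¹ = reebClass e := by
    exact (mk_eq_mk_iff (f := f * ⟨e.flow, flow_mem_pathGroup e⟩ * f⁻¹)
      (g := ⟨e.flow, flow_mem_pathGroup e⟩)).2 (homotopic_conj_flow f.2)
  exact (mul_inv_eq_iff_eq_mul.1 h).symm

theorem IsNonneg.conj {φ : UniversalCover e} (h : IsNonneg e φ) (ψ : UniversalCover e) :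
    IsNonneg e (ψ * φ * ψ⁻¹) := by
  obtain ⟨f, rfl, hf⟩ := h
  induction ψ using Con.induction_on with
  | _ g =>
  -- The representative with the fixed conjugator `g 1` is used: the velocity of the pointwise
  -- conjugate would also contain terms from the motion of `g`.
  refine ⟨⟨_, conj_path_mem f.2 g.2⟩, ?_, fun t ht => ?_⟩
  · exact ((mk_eq_mk_iff (f := g * f * g⁻¹) (g := ⟨_, conj_path_mem f.2 g.2⟩)).2
      (homotopic_conj f.2 g.2)).symm
  · rw [contactHamiltonian_nonneg_iff]
    intro x
    exact velocityForm_comp_nonneg f.2.1.smooth ht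
      (isContactomorphism_of_mem_reebContGroup (g.2.1.mem 1 ⟨zero_le_one, le_rfl⟩))
      (contactHamiltonian_nonneg_iff.1 (hf t ht) _)

/-! ### Composition with the Reeb flow. -/

/-- The velocity of `e_{a(t)} ∘ f_t` is `a'` times the Reeb field plus the image of the velocity of
`f` under the differential of `e_{a(t)}`. The value of `α` is `1` on the Reeb field, and the Reeb
flow preserves `α`. -/
theorem velocityForm_flow_mul {f : ℝ → Equiv.Perm V} (hf : IsSmoothFamily n (Icc 0 1) f)
    {a : ℝ → ℝ} {a' : ℝ} {t : ℝ} (ht : t ∈ Icc (0 : ℝ) 1)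
    (ha : HasDerivWithinAt a a' (Icc 0 1) t) (x : V) :
    velocityForm α (fun τ => e.flow (a τ) * f τ) t x = a' + velocityForm α f t x := by
  have h0 := (e.smooth.mdifferentiableAt (x := (a t, f t x)) (by simp))
  have h2 := ha.hasFDerivWithinAt.hasMFDerivWithinAt.prodMk
    (mdifferentiableWithinAt_path hf ht x).hasMFDerivWithinAt
  have h1 := (h0.hasMFDerivAt.comp_hasMFDerivWithinAt t h2).mfderivWithin
      (uniqueMDiffWithinAt_Icc ht)
  set w : 𝔼 := mfderivWithin 𝓘(ℝ, ℝ) 𝕀 (fun τ => f τ x) (Icc 0 1) t (1 : ℝ)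
  have h3 : velocityForm α (fun τ => e.flow (a τ) * f τ) t x =
      α.form (e.flow (a t) (f t x)) (mfderiv (𝓘(ℝ, ℝ).prod 𝕀) 𝕀
        (fun p : ℝ × V => e.flow p.1 p.2) (a t, f t x) (a', w)) := by
    refine (congrArg (fun L : ℝ →L[ℝ] 𝔼 => α.form (e.flow (a t) (f t x)) (L 1)) h1).trans ?_
    refine congrArg (fun u : ℝ × 𝔼 => α.form (e.flow (a t) (f t x)) (mfderiv (𝓘(ℝ, ℝ).prod 𝕀) 𝕀
        (fun p : ℝ × V => e.flow p.1 p.2) (a t, f t x) u)) ?_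
    exact Prod.ext (one_smul ℝ a') rfl
  have h4 := congrArg (fun L => L a') (e.generated (f t x) (a t)).mfderiv
  refine h3.trans ((congrArg (fun u : 𝔼 => α.form (e.flow (a t) (f t x)) u)
    (mfderiv_prod_eq_add_apply (v := ((a', w) : ℝ × 𝔼)) h0)).trans ?_)
  refine (map_add (α.form (e.flow (a t) (f t x))) _ _).trans (congrArg₂ (· + ·) ?_ ?_)
  · refine (congrArg (fun u : 𝔼 => α.form (e.flow (a t) (f t x)) u) h4).trans ?_
    refine (map_smul (α.form (e.flow (a t) (f t x))) a' _).trans ?_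
    rw [(e.isReeb _).1, smul_eq_mul, mul_one]
  · exact flow_preserves_form e (a t) (f t x) w

theorem velocityForm_one (α : ContactForm n V) (t : ℝ) (x : V) :
    velocityForm α (1 : ℝ → Equiv.Perm V) t x = 0 := by
  have h := mfderivWithin_const (I := 𝓘(ℝ, ℝ)) (I' := 𝕀) (s := Icc (0 : ℝ) 1) (x := t) (c := x)
  refine (congrArg (fun L : ℝ →L[ℝ] 𝔼 => α.form x (L 1)) h).trans ?_
  exact map_zero _

theorem velocityForm_flow {a : ℝ → ℝ} {a' : ℝ} {t : ℝ} (ht : t ∈ Icc (0 : ℝ) 1)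
    (ha : HasDerivWithinAt a a' (Icc 0 1) t) (x : V) :
    velocityForm α (fun τ => e.flow (a τ)) t x = a' := by
  have h2 := velocityForm_flow_mul (e := e) (.one : IsSmoothFamily n (Icc (0 : ℝ) 1) _) ht ha x
  rw [velocityForm_one, add_zero] at h2
  exact h2

/-! ### Cofinality of the Reeb class. -/

/-- The velocity is the tangent map of `(t, x) ↦ f t x` applied to the vector field `(1, 0)` on `ℝ ×
V`, and `α` is continuous on the tangent bundle. -/
theorem continuousOn_velocityForm {f : ℝ → Equiv.Perm V} (hf : IsSmoothFamily n (Icc 0 1) f) :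
    ContinuousOn (fun q : ℝ × V => velocityForm α f q.1 q.2) (Icc 0 1 ×ˢ univ) := by
  set S : Set (ℝ × V) := Icc (0 : ℝ) 1 ×ˢ univ with hS
  set F : ℝ × V → V := fun q => f q.1 q.2 with hF
  have hu : UniqueMDiffOn (𝓘(ℝ, ℝ).prod 𝕀) S :=
    (uniqueDiffOn_Icc zero_lt_one).uniqueMDiffOn.prod uniqueMDiffOn_univ
  have hc := hf.smooth.continuousOn_tangentMapWithin (by simp) hu
  let σ : ℝ × V → TangentBundle (𝓘(ℝ, ℝ).prod 𝕀) (ℝ × V) := fun q => ⟨q, ((1 : ℝ), (0 : 𝔼))⟩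
  have hσ : Continuous σ := by
    have h1 : Continuous (fun t : ℝ => (⟨t, (1 : ℝ)⟩ : TangentBundle 𝓘(ℝ, ℝ) ℝ)) :=
      (contMDiff_vectorSpace_iff_contDiff.2 (contDiff_const (n := 0))).continuous
    have h2 : Continuous (fun x : V => (⟨x, (0 : 𝔼)⟩ : TangentBundle 𝕀 V)) :=
      (Bundle.contMDiff_zeroSection (n := 0) (IB := 𝕀) ℝ (TangentSpace 𝕀)).continuous
    exact (contMDiff_equivTangentBundleProd_symm (n := 0)).continuous.comp
      ((h1.comp continuous_fst).prodMk (h2.comp continuous_snd))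
  have h3 := α.smooth.continuous.comp_continuousOn (hc.comp hσ.continuousOn fun q hq => hq)
  refine h3.congr fun q hq => ?_
  have h4 := ((hf.smooth q hq).mdifferentiableWithinAt (by simp)).hasMFDerivWithinAt
  -- The curve `τ ↦ (τ, x)` has velocity `(1, 0)`, so the chain rule identifies the tangent map on
  -- that field with the velocity of the path.
  have h5 : HasMFDerivWithinAt 𝓘(ℝ, ℝ) (𝓘(ℝ, ℝ).prod 𝕀) (fun τ : ℝ => (τ, q.2)) (Icc 0 1) q.1 _ :=
    (hasMFDerivWithinAt_id (I := 𝓘(ℝ, ℝ)) _ _).prodMk (hasMFDerivWithinAt_const q.2 _ _)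
  have h6 := (HasMFDerivWithinAt.comp (g := F) (u := S) q.1 h4 h5
    (fun τ hτ => ⟨hτ, mem_univ _⟩)).mfderivWithin (uniqueMDiffWithinAt_Icc hq.1)
  exact congrArg (fun L : ℝ →L[ℝ] 𝔼 => α.form (f q.1 q.2) (L 1)) h6

/-- Compactness of `[0,1] × K` bounds the value over `K`. Off `K` the path is `e_{a(t)}`, whose
value is `a'(t)`, continuous on `[0,1]` and independent of the point. -/
theorem exists_velocityForm_bound {f : ℝ → Equiv.Perm V} (hf : f ∈ pathGroup e) :
    ∃ N : ℕ, ∀ t ∈ Icc (0 : ℝ) 1, ∀ x, -(N : ℝ) ≤ velocityForm α f t x := by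
  obtain ⟨a, ha, K, hK, hfK⟩ := hf.1.outside
  obtain ⟨B, hB⟩ := ((isCompact_Icc.prod hK).image_of_continuousOn
    ((continuousOn_velocityForm (α := α) hf.1.smooth).mono
      (prod_mono_right (subset_univ K)))).bddBelow
  have hda : ContinuousOn (derivWithin a (Icc 0 1)) (Icc (0 : ℝ) 1) :=
    ha.continuousOn_derivWithin (uniqueDiffOn_Icc zero_lt_one) (by simp)
  obtain ⟨B', hB'⟩ := (isCompact_Icc.image_of_continuousOn hda).bddBelow
  obtain ⟨N, hN⟩ := exists_nat_ge (max (-B) (-B'))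
  refine ⟨N, fun t ht x => ?_⟩
  by_cases hx : x ∈ K
  · have := hB ⟨(t, x), ⟨ht, hx⟩, rfl⟩
    linarith [le_max_left (-B) (-B')]
  · have h1 := hB' ⟨t, ht, rfl⟩
    have h2 : velocityForm α f t x = velocityForm α (fun τ => e.flow (a τ)) t x := by
      have h3 := mfderivWithin_congr (I := 𝓘(ℝ, ℝ)) (I' := 𝕀) (s := Icc (0 : ℝ) 1) (x := t)
        (f := fun τ => e.flow (a τ) x) (f₁ := fun τ => f τ x)
        (fun τ hτ => hfK τ hτ x hx) (hfK t ht x hx)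
      unfold velocityForm
      refine (form_congr α (hfK t ht x hx) _).trans ?_
      exact congrArg (fun L : ℝ →L[ℝ] 𝔼 => α.form (e.flow (a t) x) (L 1)) h3
    rw [h2, velocityForm_flow ht
      ((ha.differentiableOn (by simp)) t ht).hasDerivWithinAt x]
    linarith [le_max_right (-B) (-B')]

theorem flow_natCast_mul (N : ℕ) (t : ℝ) : e.flow (N * t) = e.flow t ^ N := by
  induction N with
  | zero => simp [flow_zero]
  | succ k ih => rw [pow_succ, ← ih, ← e.flow_add]; congr 1; push_cast; ring

theorem exists_isNonneg_reebClass_pow_mul (φ : UniversalCover e) :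
    ∃ N : ℕ, IsNonneg e (reebClass e ^ N * φ) := by
  induction φ using Con.induction_on with
  | _ f =>
  obtain ⟨N, hN⟩ := exists_velocityForm_bound f.2
  -- The representative is `e_{Nt} ∘ f_t`; its value `N + velocityForm α f t x` is nonnegative by
  -- the choice of `N`.
  refine ⟨N, ⟨e.flow, flow_mem_pathGroup e⟩ ^ N * f, rfl, fun t ht => ?_⟩
  rw [contactHamiltonian_nonneg_iff]
  intro x
  have h1 : ((⟨e.flow, flow_mem_pathGroup e⟩ ^ N * f : pathGroup e) : ℝ → Equiv.Perm V) =
      fun τ => e.flow (N * τ) * (f : ℝ → Equiv.Perm V) τ := by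
    funext τ
    simp [flow_natCast_mul]
  rw [h1, velocityForm_flow_mul f.2.1.smooth ht
    (a' := N) (by simpa using ((hasDerivAt_id t).const_mul (N : ℝ)).hasDerivWithinAt) x]
  linarith [hN t ht x]

theorem isNonneg_reebClass : IsNonneg e (reebClass e) := by
  refine ⟨_, rfl, fun t ht => ?_⟩
  rw [contactHamiltonian_nonneg_iff]
  intro x
  exact (velocityForm_flow (e := e) ht (hasDerivWithinAt_id t _) x).symm ▸ zero_le_one

/-! ### Nontriviality of the universal cover. -/

theorem exists_flow_ne_one [Nonempty V] (e : PeriodicReebFlow α) : ∃ t, e.flow t ≠ 1 := by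
  by_contra! h
  obtain ⟨x⟩ := ‹Nonempty V›
  have h0 : (0 : ℝ) ∈ Icc (0 : ℝ) 1 := ⟨le_rfl, zero_le_one⟩
  have h1 : velocityForm α e.flow 0 x = 1 := velocityForm_flow h0 (hasDerivWithinAt_id 0 _) x
  -- A trivial flow would have zero velocity, whereas `α` is `1` on the Reeb field.
  have h2 : e.flow = 1 := funext h
  rw [h2, velocityForm_one] at h1
  exact zero_ne_one h1

/-- Needed because in the trivial group every `m` satisfies `e^m ≽ f`, and no minimum exists.
Homotopies fix end points, so a path `e_{ct}` ending at `e_c ≠ id` is not in the class of the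
constant path. -/
theorem nontrivial_universalCover [Nonempty V] (e : PeriodicReebFlow α) :
    Nontrivial (UniversalCover e) := by
  obtain ⟨c, hc⟩ := exists_flow_ne_one e
  have hmem : (fun t => e.flow (c * t)) ∈ pathGroup e :=
    ⟨⟨fun t _ => ⟨c * t, 1, one_mem _, (mul_one _).symm⟩, isSmoothFamily_flow e (by fun_prop),
      fun t => c * t, by fun_prop, ∅, isCompact_empty, fun _ _ _ _ => rfl⟩, by simp [flow_zero]⟩
  refine ⟨((⟨_, hmem⟩ : pathGroup e) : UniversalCover e), ((1 : pathGroup e) : UniversalCover e),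
    fun h => hc ?_⟩
  obtain ⟨F, -, h1, h2⟩ := mk_eq_mk_iff.1 h
  have h3 : (1 : ℝ) ∈ Icc (0 : ℝ) 1 := ⟨zero_le_one, le_rfl⟩
  have h4 := (h2 1 h3).2.symm.trans (h1 1 h3).2
  simpa using h4

end

end ContactGeometry

/-! ### The theorem. -/

theorem theorem2p3 {n : ℕ} {V : Type*} [TopologicalSpace V] [T2Space V]
    [SecondCountableTopology V] [Nonempty V]
    [ChartedSpace (EuclideanSpace ℝ (Fin (2 * n + 1))) V] [IsManifold (𝓡 (2 * n + 1)) ∞ V]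
    (α : ContactGeometry.ContactForm n V) (e : ContactGeometry.PeriodicReebFlow α)
    (hV : ContactGeometry.Orderable e) :
    (∀ f : ContactGeometry.UniversalCover e,
      IsLeast {m : ℤ | ContactGeometry.Succeq e (ContactGeometry.reebClass e ^ m) f}
        (ContactGeometry.nuPlus e f) ∧
      IsGreatest {m : ℤ | ContactGeometry.Succeq e f (ContactGeometry.reebClass e ^ m)}
        (ContactGeometry.nuMinus e f)) ∧
    ContactGeometry.IsConjInvariantNorm (ContactGeometry.nu e) := by
  have := ContactGeometry.nontrivial_universalCover e
  have hrefl : ∀ f, ContactGeometry.Succeq e f f := hV.refl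
  have htrans : ∀ f g h, ContactGeometry.Succeq e f g → ContactGeometry.Succeq e g h →
    ContactGeometry.Succeq e f h := hV.trans
  have hanti : ∀ f g, ContactGeometry.Succeq e f g → ContactGeometry.Succeq e g f → f = g :=
    hV.antisymm
  simp only [ContactGeometry.Succeq] at hrefl htrans hanti
  -- `Succeq e f g` unfolds to membership of `f * g⁻¹` in the cone, so the algebraic statement
  -- matches `nuPlus`, `nuMinus` and `nu` by definition.
  refine ContactGeometry.isConjInvariantNorm_of_order {φ | ContactGeometry.IsNonneg e φ}
    (ContactGeometry.reebClass e) (by simpa using hrefl 1) (fun a ha b hb => ?_)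
    (fun a ha ha' => ?_) (fun a ha g => ContactGeometry.IsNonneg.conj ha g)
    ContactGeometry.isNonneg_reebClass ContactGeometry.commute_reebClass
    ContactGeometry.exists_isNonneg_reebClass_pow_mul
  -- Closure under products is transitivity along `a * b ≽ b ≽ 1`.
  · simpa using htrans (a * b) b 1 (by simpa using ha) (by simpa using hb)
  · exact hanti a 1 (by simpa using ha) (by simpa using ha')
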